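/- Let $M\subset\mathbb{R}^D$ be a smooth closed (compact, without boundary) oriented $d$-dimensional embedded submanifold, with embedding $\iota$, and let $c>0$. Let $\mathrm{Gr}^+(D,d)$ be the oriented Grassmannian of oriented $d$-dimensional subspaces of $\mathbb{R}^D$ with its standard Riemannian metric $g^{\mathrm{Gr}^+}$ (the one which, on $T_P\mathrm{Gr}^+(D,d)=\operatorname{Hom}(P,P^\perp)$, is the Hilbert–Schmidt inner product; equivalently, it is locally given by $\tfrac12\operatorname{tr}(A^{\top}B)$ for velocities $A,B$ of the orthogonal projections onto the subspaces). Let $\bar{\mathbf g}^+:M\to\mathrm{Gr}^+(D,d)$, $p\mapsto T_pM$, be the oriented Gauss map, and let $g_c=(\iota\times\bar{\mathbf g}^+)^*\bigl(g^{\mathbb{R}^D}\oplus c\,g^{\mathrm{Gr}^+}\bigr)$. Denote by $\mathrm{vol}(M)$ the Riemannian volume of $M$ for the metric induced from $\mathbb{R}^D$ and by $\mathrm{vol}_c(M)$ the Riemannian volume of $(M,g_c)$. Let $\mathbf{II}_p(X,Y)=(\nabla_XY)^\perp$ be the second fundamental form of $M\subset\mathbb{R}^D$, where $\nabla$ is the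 flat connection of $\mathbb{R}^D$ and $\perp$ is the orthogonal projection onto the normal space $(T_pM)^\perp$; let $\|\mathbf{II}_p(v,\cdot)\|_{\mathrm{HS}}=\bigl(\sum_i\|\mathbf{II}_p(v,e_i)\|^2\bigr)^{1/2}$ for an orthonormal basis $(e_i)$ of $T_pM$, and let $a=\|\mathbf{II}\|_2=\sup_{p\in M}\sup_{v\in T_pM,\,\|v\|=1}\|\mathbf{II}_p(v,v)\|$. (Suprema over the empty set are $0$.) Then $\mathrm{vol}(M)<\infty$ and $$\mathrm{vol}_c(M)\le\Bigl(1+c\Bigl(\sup_{p\in M}\ \sup_{v\in T_pM,\ \|v\|=1}\|\mathbf{II}_p(v,\cdot)\|_{\mathrm{HS}}\Bigr)^2\Bigr)^{d/2}\,\mathrm{vol}(M).$$ In particular, $$\mathrm{vol}_c(M)\le\bigl(1+c\,a^2\min(d,D-d)\bigr)^{d/2}\,\mathrm{vol}(M).$$ -/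

import Mathlib

open scoped Manifold ContDiff

noncomputable section

namespace GaussVolume

/-- Euclidean space `ℝⁿ`. -/
abbrev Euc (n : ℕ) := EuclideanSpace ℝ (Fin n)

section Grassmannian

/-- The oriented Grassmannian `Gr⁺(D, d)`: the set of oriented `d`-dimensional linear subspaces
of `ℝ^D`. -/
structure OrientedGrassmannian (D d : ℕ) where
  /-- the underlying linear subspace -/
  toSubmodule : Submodule ℝ (Euc D)
  finrank_eq : Module.finrank ℝ toSubmodule = d
  /-- the orientation of the subspace -/
  orientation : Orientation ℝ toSubmodule (Fin d)

/-- The covering `Gr⁺(D, d) → Gr(D, d)` forgetting orientations, where the Grassmannian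
`Gr(D, d)` is realized as the manifold of orthogonal projections of rank `d` in `End(ℝ^D)`. -/
def OrientedGrassmannian.proj {D d : ℕ} (P : OrientedGrassmannian D d) : Euc D →L[ℝ] Euc D :=
  P.toSubmodule.starProjection

/-- The standard Riemannian metric of the Grassmannian in the projection model,
`g(A, B) = ½ tr(Aᵀ B)`, where a tangent vector is given by the velocity of the orthogonal
projection.  The velocity `A` of the projection corresponds to `T = (A restricted to P)` in
`Hom(P, Pᗮ)`, and `g(A, A)` is the squared Hilbert–Schmidt norm of `T`; the associated geodesic
distance is the Euclidean norm of the vector of principal angles.  As `Gr⁺ → Gr` is a Riemannian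
covering, this is also the metric of `Gr⁺` evaluated on a tangent vector that is given by the
velocity of the projection. -/
def grassmannMetric {D : ℕ} (A B : Euc D →L[ℝ] Euc D) : ℝ :=
  (1 / 2) * LinearMap.trace ℝ (Euc D) (A.adjoint ∘L B).toLinearMap

end Grassmannian

section Manifold

variable {d D : ℕ} {M : Type*} [TopologicalSpace M] [ChartedSpace (Euc d) M]

/-- A continuous choice of orientations of the tangent spaces of `M`: around every point, the
differential of the chart centred there carries `o p` to a constant orientation of `ℝ^d`. -/
def IsManifoldOrientation (o : ∀ p : M, Orientation ℝ (TangentSpace (𝓡 d) p) (Fin d)) : Prop :=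
  ∀ x₀ : M, ∃ o₀ : Orientation ℝ (Euc d) (Fin d), ∀ᶠ p in nhds x₀,
    ∃ A : TangentSpace (𝓡 d) p ≃ₗ[ℝ] Euc d,
      (∀ v, A v = mfderiv (𝓡 d) (𝓡 d) (extChartAt (𝓡 d) x₀) p v) ∧
        Orientation.map (Fin d) A (o p) = o₀

/-- The differential `df_p : T_pM → F` of a map `f` into a normed space `F`. -/
def differential {F : Type*} [NormedAddCommGroup F] [NormedSpace ℝ F] (d : ℕ) {M : Type*}
    [TopologicalSpace M] [ChartedSpace (Euc d) M] (f : M → F) (p : M) :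
    TangentSpace (𝓡 d) p →L[ℝ] F :=
  mfderiv (𝓡 d) 𝓘(ℝ, F) f p

section Embedding

/-- The differential of a smooth embedding is injective. -/
theorem injective_differential [IsManifold (𝓡 d) ∞ M] {ι : M → Euc D}
    (hι : Manifold.IsSmoothEmbedding (𝓡 d) (𝓡 D) ∞ ι) (p : M) :
    Function.Injective (differential d ι p) := by
  have h := hι.isImmersion.isImmersionAt p
  have hsrc := h.mem_domChart_source
  have hd : h.domChart.MDifferentiable (𝓡 d) (𝓡 d) :=
    ⟨fun x hx => (((contMDiffOn_of_mem_maximalAtlas h.domChart_mem_maximalAtlas) x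
        hx).mdifferentiableWithinAt (by simp)),
      fun x hx => (((contMDiffOn_symm_of_mem_maximalAtlas h.domChart_mem_maximalAtlas) x
        hx).mdifferentiableWithinAt (by simp))⟩
  have hc : MDifferentiableAt (𝓡 D) (𝓡 D) h.codChart (ι p) :=
    (contMDiffAt_of_mem_maximalAtlas h.codChart_mem_maximalAtlas
      h.mem_codChart_source).mdifferentiableAt (by simp)
  have hf : MDifferentiableAt (𝓡 d) (𝓡 D) ι p :=
    hι.contMDiff.contMDiffAt.mdifferentiableAt (by simp)
  let L : Euc d →L[ℝ] Euc D :=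
    (h.equiv : (Euc d × h.complement) →L[ℝ] Euc D) ∘L ContinuousLinearMap.inl ℝ _ _
  have hL : Function.Injective L := fun x y hxy => by
    have := h.equiv.injective hxy
    exact congrArg Prod.fst this
  have heq : (h.codChart ∘ ι) =ᶠ[nhds p] (L ∘ h.domChart) := by
    filter_upwards [h.domChart.open_source.mem_nhds hsrc] with q hq
    have hq' : h.domChart q ∈ (h.domChart.extend (𝓡 d)).target := by
      simpa using h.domChart.map_source hq
    have := h.writtenInCharts hq'
    simpa [hq, L] using this
  have hcomp := mfderiv_comp p hc hf
  have hcomp' := mfderiv_comp (I := 𝓡 d) (I' := 𝓡 d) (I'' := 𝓡 D) p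
    (L.mdifferentiableAt (x := h.domChart p)) (hd.mdifferentiableAt hsrc)
  rw [heq.mfderiv_eq, hcomp'] at hcomp
  have hinj : Function.Injective ((mfderiv (𝓡 d) (𝓡 D) L (h.domChart p)).comp
      (mfderiv (𝓡 d) (𝓡 d) h.domChart p)) := by
    rw [L.mfderiv_eq]
    exact hL.comp (hd.mfderiv_injective hsrc)
  rw [hcomp] at hinj
  exact Function.Injective.of_comp hinj

/-- The tangent space `T_pM` as a linear subspace of `ℝ^D`, namely the image of `dι_p`. -/
def tangentSubspace (d : ℕ) {M : Type*} [TopologicalSpace M] [ChartedSpace (Euc d) M]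
    (ι : M → Euc D) (p : M) : Submodule ℝ (Euc D) :=
  LinearMap.range (differential d ι p).toLinearMap

variable [IsManifold (𝓡 d) ∞ M] {ι : M → Euc D}

/-- The differential `dι_p` as an isomorphism from the abstract tangent space onto the subspace
`T_pM ⊂ ℝ^D`. -/
def tangentEquiv (hι : Manifold.IsSmoothEmbedding (𝓡 d) (𝓡 D) ∞ ι) (p : M) :
    TangentSpace (𝓡 d) p ≃ₗ[ℝ] tangentSubspace d ι p :=
  LinearEquiv.ofInjective (differential d ι p).toLinearMap (injective_differential hι p)

theorem finrank_tangentSubspace (hι : Manifold.IsSmoothEmbedding (𝓡 d) (𝓡 D) ∞ ι) (p : M) :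
    Module.finrank ℝ (tangentSubspace d ι p) = d := by
  rw [← (tangentEquiv hι p).finrank_eq]
  exact finrank_euclideanSpace_fin

/-- The oriented Gauss map `M → Gr⁺(D, d)`, sending `p` to the subspace `T_pM ⊂ ℝ^D` with the
orientation given by the orientation of `M`. -/
def gaussMap (hι : Manifold.IsSmoothEmbedding (𝓡 d) (𝓡 D) ∞ ι)
    (o : ∀ p : M, Orientation ℝ (TangentSpace (𝓡 d) p) (Fin d)) (p : M) :
    OrientedGrassmannian D d where
  toSubmodule := tangentSubspace d ι p
  finrank_eq := finrank_tangentSubspace hι p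
  orientation := Orientation.map (Fin d) (tangentEquiv hι p) (o p)

end Embedding

section Metrics

/-- The Euclidean metric of `M`: the pullback along `ι` of the inner product of `ℝ^D`. -/
def euclideanMetric (ι : M → Euc D) (p : M) (u v : TangentSpace (𝓡 d) p) : ℝ :=
  inner ℝ (differential d ι p u) (differential d ι p v)

/-- The pullback along `F : M → ℝ^D × Gr⁺(D, d)` of the product of the Euclidean metric and `c`
times the metric of the oriented Grassmannian. -/
def pullbackMetric (c : ℝ) (F : M → Euc D × OrientedGrassmannian D d) (p : M)
    (u v : TangentSpace (𝓡 d) p) : ℝ :=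
  inner ℝ (differential d (fun q => (F q).1) p u) (differential d (fun q => (F q).1) p v) +
    c * grassmannMetric (differential d (fun q => (F q).2.proj) p u)
      (differential d (fun q => (F q).2.proj) p v)

/-- The metric `g_c` on `M`: the pullback of the product metric along the graph embedding
`p ↦ (ι p, gaussMap p)`. -/
def gaussMetric [IsManifold (𝓡 d) ∞ M] {ι : M → Euc D}
    (hι : Manifold.IsSmoothEmbedding (𝓡 d) (𝓡 D) ∞ ι)
    (o : ∀ p : M, Orientation ℝ (TangentSpace (𝓡 d) p) (Fin d)) (c : ℝ) :
    ∀ p : M, TangentSpace (𝓡 d) p → TangentSpace (𝓡 d) p → ℝ :=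
  pullbackMetric c fun q => (ι q, gaussMap hι o q)

end Metrics

section Volume

/-- The `k`-th coordinate vector field of the chart centred at `x₀`, at the point with
coordinates `y`. -/
def coordVector (x₀ : M) (y : Euc d) (k : Fin d) :
    TangentSpace (𝓡 d) ((extChartAt (𝓡 d) x₀).symm y) :=
  mfderiv (𝓡 d) (𝓡 d) (extChartAt (𝓡 d) x₀).symm y (EuclideanSpace.single k (1 : ℝ) : Euc d)

/-- The density `√(det g_{ij})` of the Riemannian volume of `g` in the chart centred at `x₀`, at
the point with coordinates `y`. -/
def volumeDensity (g : ∀ p : M, TangentSpace (𝓡 d) p → TangentSpace (𝓡 d) p → ℝ) (x₀ : M)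
    (y : Euc d) : ℝ :=
  √(Matrix.det (Matrix.of fun i j : Fin d =>
    g ((extChartAt (𝓡 d) x₀).symm y) (coordVector x₀ y i) (coordVector x₀ y j)))

variable [IsManifold (𝓡 d) ∞ M] [T2Space M] [CompactSpace M]

variable (d M) in
/-- A smooth partition of unity on `M`, indexed by the points of `M`, the function with index `x₀`
being supported in the domain of the chart centred at `x₀`. -/
def chartPartition : SmoothPartitionOfUnity M (𝓡 d) M Set.univ :=
  (SmoothPartitionOfUnity.exists_isSubordinate_chartAt_source (𝓡 d) M).choose

variable (d M) in
theorem chartPartition_isSubordinate :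
    (chartPartition d M).IsSubordinate fun x => (chartAt (Euc d) x).source :=
  (SmoothPartitionOfUnity.exists_isSubordinate_chartAt_source (𝓡 d) M).choose_spec

/-- The Riemannian volume of `(M, g)`: the integral over `M` of the Riemannian density, computed
in charts by means of a partition of unity (the value does not depend on the partition of unity). -/
def riemannianVolume (g : ∀ p : M, TangentSpace (𝓡 d) p → TangentSpace (𝓡 d) p → ℝ) : ENNReal :=
  ∑' x₀ : M, ∫⁻ y in (extChartAt (𝓡 d) x₀).target,
    ENNReal.ofReal (chartPartition d M x₀ ((extChartAt (𝓡 d) x₀).symm y) * volumeDensity g x₀ y)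

end Volume

section SecondFundamentalForm

/-- For a vector field `Y` on `M` and `u ∈ T_pM`, the vector `(∇_u Y)^⊥`, where `∇` is the flat
connection of `ℝ^D` (the directional derivative) and `⊥` is the projection onto the normal space
`ν_p = (T_pM)^⊥`. -/
def normalDerivative (ι : M → Euc D) (p : M) (u : TangentSpace (𝓡 d) p)
    (Y : ∀ q : M, TangentSpace (𝓡 d) q) : Euc D :=
  (tangentSubspace d ι p)ᗮ.starProjection
    (differential d (fun q => differential d ι q (Y q)) p u)

/-- The extension of `w ∈ T_pM` to a vector field near `p` that has constant coefficients in the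
chart centred at `p`. -/
def extendTangent (p : M) (w : TangentSpace (𝓡 d) p) : ∀ q : M, TangentSpace (𝓡 d) q :=
  VectorField.mpullback (𝓡 d) (𝓡 d) (extChartAt (𝓡 d) p)
    fun _ => mfderiv (𝓡 d) (𝓡 d) (extChartAt (𝓡 d) p) p w

variable [IsManifold (𝓡 d) ∞ M]

theorem extendTangent_self (p : M) (w : TangentSpace (𝓡 d) p) : extendTangent p w p = w := by
  have : IsManifold (𝓡 d) 1 M := IsManifold.of_le (n := ∞) (by simp)
  exact (isInvertible_mfderiv_extChartAt (mem_extChartAt_source p)).inverse_apply_eq.2 rfl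

variable {ι : M → Euc D}

/-- The second fundamental form `II_p(x, y) = (∇_X Y)^⊥` at `p`, for `x, y ∈ T_pM ⊂ ℝ^D`, where
`Y` is a tangent vector field that extends `y`. -/
def secondFundamentalForm (hι : Manifold.IsSmoothEmbedding (𝓡 d) (𝓡 D) ∞ ι) (p : M)
    (x y : tangentSubspace d ι p) : Euc D :=
  normalDerivative ι p ((tangentEquiv hι p).symm x)
    (extendTangent p ((tangentEquiv hι p).symm y))

/-- The Hilbert–Schmidt norm `(∑ᵢ ‖A eᵢ‖²)^{1/2}` of a linear map `A`, with `(eᵢ)` an orthonormal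
basis of `V`. -/
def hsNorm {V W : Type*} [NormedAddCommGroup V] [InnerProductSpace ℝ V] [FiniteDimensional ℝ V]
    [NormedAddCommGroup W] (A : V → W) : ℝ :=
  √(∑ i, ‖A (stdOrthonormalBasis ℝ V i)‖ ^ 2)

/-- The supremum over `p ∈ M` and unit vectors `v ∈ T_pM` of the Hilbert–Schmidt norm of
`II_p(v, ·)`. -/
def hsSup (hι : Manifold.IsSmoothEmbedding (𝓡 d) (𝓡 D) ∞ ι) : ℝ :=
  ⨆ p : M, ⨆ v : Metric.sphere (0 : tangentSubspace d ι p) 1,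
    hsNorm fun y => secondFundamentalForm hι p v y

/-- The operator norm `‖II‖₂`: the supremum over `p ∈ M` and unit vectors `v ∈ T_pM` of the
normal curvature `‖II_p(v, v)‖`. -/
def curvatureNorm (hι : Manifold.IsSmoothEmbedding (𝓡 d) (𝓡 D) ∞ ι) : ℝ :=
  ⨆ p : M, ⨆ v : Metric.sphere (0 : tangentSubspace d ι p) 1,
    ‖secondFundamentalForm hι p v v‖

end SecondFundamentalForm

end Manifold

end GaussVolume

end

open GaussVolume

namespace GaussVolume

/-! ### Determinants of positive semidefinite matrices; velocities of orthogonal projections -/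

section LinearAlgebra

/-! Let `P` be the orthogonal projection onto the tangent space. Differentiating `P² = P` and `P* =
P` shows that its velocity `A = dP(u)` is symmetric and off-diagonal for `T ⊕ Tᗮ`, so `½ tr(AᵀA)` is
the squared Hilbert–Schmidt norm of `A` on `T` (`half_trace_eq_sum`). Differentiating `P (dι w) = dι
w` in a chart gives `II(x, y) = dP(x) y` (`secondFundamentalForm_eq_differential`). Hence `g_c(u, u)
= |u|² + c ‖II(u, ·)‖²_HS ≤ r |u|²` with `r = 1 + c s²`, where `s` is the supremum in the first
estimate.

Monotonicity of the determinant turns this into a factor `r ^ d` between Gram determinants, hence `r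
^ (d / 2)` between densities (`sqrt_det_gram_le`), and the volumes are compared chart by chart. The
Euclidean volume is finite because its density is continuous and the partition of unity has finitely
many nonzero members, compactly supported in their charts.

For the second estimate, polarization gives `‖II(x, y)‖ ≤ a` on unit vectors. An orthonormal basis
of `T` yields the factor `d`; since `A` on `Tᗮ` is the adjoint of `A` on `T`, a basis of `Tᗮ` yields
`D - d` (`sum_norm_sq_le_mul_min`). -/

theorem one_le_det_one_add {n : Type*} [Fintype n] [DecidableEq n] {H : Matrix n n ℝ}
    (hH : H.PosSemidef) : 1 ≤ (1 + H).det := by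
  have hB : (1 + H).IsHermitian := Matrix.isHermitian_one.add hH.isHermitian
  rw [hB.det_eq_prod_eigenvalues]
  refine Finset.one_le_prod (fun i => ?_)
  -- An eigenvalue of `1 + H` is the Rayleigh quotient `1 + ⟨v, H v⟩` at a unit eigenvector `v`.
  have h := hB.eigenvalues_eq i
  have h1 := hH.dotProduct_mulVec_nonneg (hB.eigenvectorBasis i).ofLp
  have h2 : star (hB.eigenvectorBasis i).ofLp ⬝ᵥ (hB.eigenvectorBasis i).ofLp = 1 := by
    have := hB.eigenvectorBasis.orthonormal.1 i
    have h3 := real_inner_self_eq_norm_sq (hB.eigenvectorBasis i)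
    rw [this, EuclideanSpace.inner_eq_star_dotProduct, dotProduct_comm] at h3
    simpa using h3
  rw [Matrix.add_mulVec, Matrix.one_mulVec, dotProduct_add, h2] at h
  simp at h h1 ⊢
  linarith

open scoped MatrixOrder in
/-- The determinant is monotone on positive semidefinite real matrices. -/
theorem det_le_det_of_posSemidef_sub {n : Type*} [Fintype n] [DecidableEq n]
    {A B : Matrix n n ℝ} (hA : A.PosSemidef) (hAB : (B - A).PosSemidef) : A.det ≤ B.det := by
  rcases eq_or_ne A.det 0 with h0 | h0
  · rw [h0, show B = A + (B - A) by abel]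
    exact (hA.add hAB).det_nonneg
  -- With `A = C* C` and `C` invertible, a congruence by `C` moves `A` to the identity: `B = C* (1 +
  -- H) C` with `H` positive semidefinite.
  · obtain ⟨C, hC⟩ := CStarAlgebra.nonneg_iff_eq_star_mul_self.mp hA.nonneg
    rw [Matrix.star_eq_conjTranspose] at hC
    have hCu : IsUnit C.det := by
      rw [hC, Matrix.det_mul] at h0
      exact isUnit_iff_ne_zero.2 (right_ne_zero_of_mul h0)
    have hCu' : IsUnit C.conjTranspose.det := by simpa using hCu
    set H := (C⁻¹).conjTranspose * (B - A) * C⁻¹ with hHdef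
    have hH : H.PosSemidef := hAB.conjTranspose_mul_mul_same _
    have hB : B = C.conjTranspose * (1 + H) * C := by
      have : C.conjTranspose * H * C = B - A := by
        rw [hHdef, Matrix.conjTranspose_nonsing_inv]
        simp only [Matrix.mul_assoc]
        rw [Matrix.nonsing_inv_mul _ hCu, Matrix.mul_one, ← Matrix.mul_assoc,
          Matrix.mul_nonsing_inv _ hCu', Matrix.one_mul]
      rw [Matrix.mul_add, Matrix.add_mul, this, Matrix.mul_one, ← hC]
      abel
    have hd : B.det = A.det * (1 + H).det := by
      rw [hB, hC, Matrix.det_mul, Matrix.det_mul, Matrix.det_mul]; ring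
    rw [hd]
    exact le_mul_of_one_le_right hA.det_nonneg (one_le_det_one_add hH)

variable {W : Type*} [NormedAddCommGroup W] [InnerProductSpace ℝ W] [FiniteDimensional ℝ W]

/-- `trace (B ∘ P_T)` is the trace of the compression of `B` to `T`. -/
theorem trace_comp_starProjection (T : Submodule ℝ W) (B : W →L[ℝ] W) {ι : Type} [Fintype ι]
    (e : OrthonormalBasis ι ℝ T) :
    LinearMap.trace ℝ W (B ∘L T.starProjection).toLinearMap
      = ∑ i, inner ℝ (e i : W) (B (e i)) := by
  have h : (B ∘L T.starProjection).toLinearMap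
      = (B.toLinearMap ∘ₗ T.subtype) ∘ₗ T.orthogonalProjectionOnto.toLinearMap := by
    rfl
  rw [h, LinearMap.trace_comp_comm', LinearMap.trace_eq_sum_inner _ e]
  refine Finset.sum_congr rfl fun i _ => ?_
  exact Submodule.inner_orthogonalProjectionOnto_eq_of_mem_left _ _

/-- Half the squared Hilbert–Schmidt norm of a velocity `A` of orthogonal projections at `P_T` is
the squared Hilbert–Schmidt norm of the restriction of `A` to `T`. -/
theorem half_trace_eq_sum {T : Submodule ℝ W} {A : W →L[ℝ] W}
    (hsym : A.adjoint = A)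
    (hA : A ∘L T.starProjection + T.starProjection ∘L A = A) {ι : Type} [Fintype ι]
    (e : OrthonormalBasis ι ℝ T) :
    (1 / 2) * LinearMap.trace ℝ W (A.adjoint ∘L A).toLinearMap = ∑ i, ‖A (e i)‖ ^ 2 := by
  -- Inserting `A = AP + PA` in the second factor splits `A A` into `A A P` and `A P A`. These have
  -- equal traces by cyclicity, which absorbs the factor `½`.
  have h1 : (A.adjoint ∘L A).toLinearMap =
      ((A ∘L A) ∘L T.starProjection).toLinearMap +
        ((A ∘L T.starProjection).toLinearMap ∘ₗ A.toLinearMap) := by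
    rw [hsym]
    nth_rewrite 2 [← hA]
    ext x; simp
  have h2 : LinearMap.trace ℝ W ((A ∘L T.starProjection).toLinearMap ∘ₗ A.toLinearMap) =
      LinearMap.trace ℝ W ((A ∘L A) ∘L T.starProjection).toLinearMap := by
    rw [LinearMap.trace_comp_comm']; rfl
  rw [h1, map_add, h2, trace_comp_starProjection T (A ∘L A) e, ← two_mul, ← mul_assoc]
  norm_num
  refine Finset.sum_congr rfl fun i _ => ?_
  rw [← real_inner_self_eq_norm_sq]
  nth_rewrite 1 [← hsym]
  rw [ContinuousLinearMap.adjoint_inner_right]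

/-- The blocks `T → Tᗮ` and `Tᗮ → T` of `A` are adjoint to each other, so they share both the
operator bound `a` and the Hilbert–Schmidt norm; the sum may be counted over a basis of either
space. -/
theorem sum_norm_sq_le_mul_min {T : Submodule ℝ W} {A : W →L[ℝ] W} (hsym : A.adjoint = A)
    (hA : A ∘L T.starProjection + T.starProjection ∘L A = A) {a : ℝ} (ha0 : 0 ≤ a)
    (ha : ∀ x ∈ T, ‖A x‖ ≤ a * ‖x‖) {ι : Type} [Fintype ι] (e : OrthonormalBasis ι ℝ T) :
    ∑ i, ‖A (e i)‖ ^ 2 ≤ a ^ 2 *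
      (min (Module.finrank ℝ T) (Module.finrank ℝ W - Module.finrank ℝ T) : ℕ) := by
  have key : ∀ {S : Submodule ℝ W} {κ : Type} [Fintype κ] (f : OrthonormalBasis κ ℝ S),
      (∀ x ∈ S, ‖A x‖ ≤ a * ‖x‖) → ∑ i, ‖A (f i)‖ ^ 2 ≤ a ^ 2 * Module.finrank ℝ S := by
    intro S κ _ f hS
    calc ∑ i, ‖A (f i)‖ ^ 2 ≤ ∑ _i : κ, a ^ 2 := by
          refine Finset.sum_le_sum fun i _ => ?_
          have := hS _ (f i).2
          rw [← Submodule.coe_norm, f.orthonormal.1 i, mul_one] at this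
          gcongr
      _ = _ := by
          rw [Finset.sum_const, Module.finrank_eq_card_basis f.toBasis]
          simp [mul_comm]
  rw [Nat.cast_min, mul_min_of_nonneg _ _ (sq_nonneg a), le_min_iff]
  refine ⟨key e ha, ?_⟩
  have hperp : ∀ n ∈ Tᗮ, A n ∈ T := by
    intro n hn
    have := congrArg (fun B : W →L[ℝ] W => B n) hA
    simp only [_root_.add_apply, ContinuousLinearMap.comp_apply,
      (Submodule.starProjection_apply_eq_zero_iff T).2 hn, map_zero, zero_add] at this
    exact Submodule.starProjection_eq_self_iff.1 this
  -- `‖A n‖² = ⟨n, A (A n)⟩` with `A n ∈ T`, so the bound on `T` applies to the inner `A n`, and one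
  -- factor `‖A n‖` cancels.
  have hb : ∀ n ∈ Tᗮ, ‖A n‖ ≤ a * ‖n‖ := by
    intro n hn
    rcases (norm_nonneg (A n)).eq_or_lt with h0 | h0
    · rw [← h0]; positivity
    · have h1 : ‖A n‖ * ‖A n‖ ≤ (a * ‖n‖) * ‖A n‖ := by
        calc ‖A n‖ * ‖A n‖ = inner ℝ (A n) (A n) := (real_inner_self_eq_norm_mul_norm _).symm
          _ = inner ℝ n (A (A n)) := by
              nth_rewrite 1 [← hsym]
              rw [ContinuousLinearMap.adjoint_inner_left]
          _ ≤ ‖n‖ * ‖A (A n)‖ := real_inner_le_norm _ _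
          _ ≤ ‖n‖ * (a * ‖A n‖) := by gcongr; exact ha _ (hperp n hn)
          _ = _ := by ring
      exact le_of_mul_le_mul_right h1 h0
  -- The complementary projection `1 - P` has velocity `-A`, so `half_trace_eq_sum` evaluates the
  -- same trace over `Tᗮ`.
  have hA' : (-A) ∘L Tᗮ.starProjection + Tᗮ.starProjection ∘L (-A) = -A := by
    rw [Submodule.starProjection_orthogonal']
    ext x
    have := congrArg (fun B : W →L[ℝ] W => B x) hA
    simp only [_root_.add_apply, ContinuousLinearMap.comp_apply] at this
    simp only [_root_.add_apply, ContinuousLinearMap.comp_apply,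
      _root_.neg_apply, _root_.sub_apply, map_sub,
      one_apply_eq_self, map_neg]
    linear_combination (norm := module) this
  have e1 := half_trace_eq_sum hsym hA e
  have e2 := half_trace_eq_sum (A := -A) (by rw [map_neg, hsym]) hA' (stdOrthonormalBasis ℝ Tᗮ)
  have e3 : (ContinuousLinearMap.adjoint (-A)) ∘L (-A) = A.adjoint ∘L A := by
    rw [map_neg]; ext; simp
  rw [e3, e1] at e2
  rw [e2]
  simp only [_root_.neg_apply, norm_neg]
  refine (key (stdOrthonormalBasis ℝ Tᗮ) hb).trans_eq ?_
  rw [← T.finrank_add_finrank_orthogonal]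
  simp

/-- The orthogonal projection onto the range of an injective map. -/
theorem starProjection_range_eq {V : Type*} [NormedAddCommGroup V] [InnerProductSpace ℝ V]
    [FiniteDimensional ℝ V] {B : V →L[ℝ] W} (hB : Function.Injective B) :
    IsUnit (B.adjoint ∘L B : V →L[ℝ] V) ∧
    (LinearMap.range B.toLinearMap).starProjection =
      B ∘L (Ring.inverse (B.adjoint ∘L B : V →L[ℝ] V)) ∘L B.adjoint := by
  have hinj : Function.Injective (B.adjoint ∘L B) := by
    refine (injective_iff_map_eq_zero _).2 fun v hv => ?_
    have : inner ℝ v ((B.adjoint ∘L B) v) = 0 := by rw [hv, inner_zero_right]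
    rw [ContinuousLinearMap.comp_apply, ContinuousLinearMap.adjoint_inner_right,
      inner_self_eq_zero] at this
    exact hB (this.trans (map_zero B).symm)
  have hu : IsUnit (B.adjoint ∘L B : V →L[ℝ] V) := by
    rw [ContinuousLinearMap.isUnit_iff_bijective]
    exact ⟨hinj, LinearMap.injective_iff_surjective.1 hinj⟩
  refine ⟨hu, ?_⟩
  ext1 w
  refine Submodule.eq_starProjection_of_mem_orthogonal
    (LinearMap.mem_range_self B.toLinearMap _) ?_
  rintro _ ⟨v, rfl⟩
  have h := Ring.mul_inverse_cancel _ hu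
  have h' := congrArg (fun C : V →L[ℝ] V => C (B.adjoint w)) h
  simp only [mul_apply_eq_comp, one_apply_eq_self,
    ContinuousLinearMap.comp_apply] at h'
  simp only [ContinuousLinearMap.coe_coe, ContinuousLinearMap.comp_apply]
  rw [← ContinuousLinearMap.adjoint_inner_right, map_sub, h', sub_self, inner_zero_right]

/-- The formula `B (B* B)⁻¹ B*` involves only linear operations, composition and inversion at a
unit, all smooth; it represents the projection wherever `B y` is injective. -/
theorem contDiffAt_starProjection_range {V E : Type*} [NormedAddCommGroup V]
    [InnerProductSpace ℝ V] [FiniteDimensional ℝ V] [NormedAddCommGroup E] [NormedSpace ℝ E]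
    {n : ℕ∞ω} {B : E → V →L[ℝ] W} {y₀ : E} (hB : ContDiffAt ℝ n B y₀)
    (hinj : ∀ᶠ y in nhds y₀, Function.Injective (B y)) :
    ContDiffAt ℝ n (fun y => (LinearMap.range (B y).toLinearMap).starProjection) y₀ := by
  have hadj : ContDiffAt ℝ n (fun y => (B y).adjoint) y₀ :=
    (ContinuousLinearMap.adjoint (𝕜 := ℝ) (E := V) (F := W)).toLinearIsometry
      |>.contDiff.contDiffAt.comp y₀ hB
  have hu := (starProjection_range_eq hinj.self_of_nhds).1
  have hinv : ContDiffAt ℝ n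
      (fun y => Ring.inverse ((B y).adjoint ∘L (B y) : V →L[ℝ] V)) y₀ := by
    have h := contDiffAt_ringInverse ℝ (n := n) hu.unit
    exact ContDiffAt.comp y₀ h (hadj.clm_comp hB)
  refine (hB.clm_comp (hinv.clm_comp hadj)).congr_of_eventuallyEq ?_
  filter_upwards [hinj] with y hy
  exact (starProjection_range_eq hy).2

end LinearAlgebra

/-! ### The tangential projection in charts and the second fundamental form -/

section Charts

variable {d D : ℕ} {M : Type*} [TopologicalSpace M] [ChartedSpace (Euc d) M]

/-- Allowing any point `q` of the chart domain, not just its centre, is what later gives estimates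
uniform near `x₀`. -/
theorem differential_eq_fderiv_comp [IsManifold (𝓡 d) ∞ M] {F : Type*} [NormedAddCommGroup F]
    [NormedSpace ℝ F] {g : M → F} {x₀ q : M} (hq : q ∈ (extChartAt (𝓡 d) x₀).source)
    (hg : DifferentiableAt ℝ (g ∘ (extChartAt (𝓡 d) x₀).symm) (extChartAt (𝓡 d) x₀ q)) :
    differential d g q =
      (fderiv ℝ (g ∘ (extChartAt (𝓡 d) x₀).symm) (extChartAt (𝓡 d) x₀ q)).comp
        (mfderiv (𝓡 d) (𝓡 d) (extChartAt (𝓡 d) x₀) q) := by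
  have : IsManifold (𝓡 d) 1 M := IsManifold.of_le (n := ∞) (by simp)
  have h1 : HasMFDerivAt (𝓡 d) 𝓘(ℝ, F) ((g ∘ (extChartAt (𝓡 d) x₀).symm) ∘ extChartAt (𝓡 d) x₀) q
      ((fderiv ℝ (g ∘ (extChartAt (𝓡 d) x₀).symm) (extChartAt (𝓡 d) x₀ q)).comp
        (mfderiv (𝓡 d) (𝓡 d) (extChartAt (𝓡 d) x₀) q)) :=
    HasMFDerivAt.comp q hg.hasFDerivAt.hasMFDerivAt
      (mdifferentiableAt_extChartAt (by simpa using hq)).hasMFDerivAt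
  refine (h1.congr_of_eventuallyEq ?_).mfderiv
  filter_upwards [(isOpen_extChartAt_source (I := 𝓡 d) x₀).mem_nhds hq] with r hr
  simp only [Function.comp_apply, (extChartAt (𝓡 d) x₀).left_inv hr]

theorem mfderiv_extChartAt_surjective [IsManifold (𝓡 d) ∞ M] {x₀ q : M}
    (hq : q ∈ (extChartAt (𝓡 d) x₀).source) :
    Function.Surjective (mfderiv (𝓡 d) (𝓡 d) (extChartAt (𝓡 d) x₀) q) := by
  have : IsManifold (𝓡 d) 1 M := IsManifold.of_le (n := ∞) (by simp)
  exact (isInvertible_mfderiv_extChartAt hq).bijective.surjective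

theorem contDiffOn_comp_extChartAt_symm {F : Type*} [NormedAddCommGroup F] [NormedSpace ℝ F]
    {n : ℕ∞ω} [IsManifold (𝓡 d) n M] {g : M → F} (hg : ContMDiff (𝓡 d) 𝓘(ℝ, F) n g) (x₀ : M) :
    ContDiffOn ℝ n (g ∘ (extChartAt (𝓡 d) x₀).symm) (extChartAt (𝓡 d) x₀).target :=
  contMDiffOn_iff_contDiffOn.1 (hg.comp_contMDiffOn (contMDiffOn_extChartAt_symm x₀))

theorem contDiffAt_comp_extChartAt_symm {F : Type*} [NormedAddCommGroup F] [NormedSpace ℝ F]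
    {n : ℕ∞ω} [IsManifold (𝓡 d) n M] {g : M → F} (hg : ContMDiff (𝓡 d) 𝓘(ℝ, F) n g) {x₀ : M}
    {y : Euc d} (hy : y ∈ (extChartAt (𝓡 d) x₀).target) :
    ContDiffAt ℝ n (g ∘ (extChartAt (𝓡 d) x₀).symm) y :=
  (contDiffOn_comp_extChartAt_symm hg x₀).contDiffAt
    ((isOpen_extChartAt_target (I := 𝓡 d) x₀).mem_nhds hy)

/-- The orthogonal projection onto the tangent space. -/
noncomputable def tangentProj (d : ℕ) {M : Type*} [TopologicalSpace M] [ChartedSpace (Euc d) M]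
    (ι : M → Euc D) (q : M) : Euc D →L[ℝ] Euc D :=
  (tangentSubspace d ι q).starProjection

theorem adjoint_tangentProj {ι : M → Euc D} (q : M) :
    (tangentProj d ι q).adjoint = tangentProj d ι q :=
  (isSelfAdjoint_starProjection (tangentSubspace d ι q)).adjoint_eq

theorem tangentProj_comp_self {ι : M → Euc D} (q : M) :
    tangentProj d ι q ∘L tangentProj d ι q = tangentProj d ι q :=
  (tangentSubspace d ι q).isIdempotentElem_starProjection

variable [IsManifold (𝓡 d) ∞ M] {ι : M → Euc D}

theorem differential_embedding_eq (hι : Manifold.IsSmoothEmbedding (𝓡 d) (𝓡 D) ∞ ι) {x₀ q : M}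
    (hq : q ∈ (extChartAt (𝓡 d) x₀).source) :
    differential d ι q =
      (fderiv ℝ (ι ∘ (extChartAt (𝓡 d) x₀).symm) (extChartAt (𝓡 d) x₀ q)).comp
        (mfderiv (𝓡 d) (𝓡 d) (extChartAt (𝓡 d) x₀) q) :=
  differential_eq_fderiv_comp hq ((contDiffAt_comp_extChartAt_symm hι.contMDiff
    ((extChartAt (𝓡 d) x₀).map_source hq)).differentiableAt (by simp))

theorem tangentSubspace_eq_range_fderiv (hι : Manifold.IsSmoothEmbedding (𝓡 d) (𝓡 D) ∞ ι)
    {x₀ q : M} (hq : q ∈ (extChartAt (𝓡 d) x₀).source) :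
    tangentSubspace d ι q = LinearMap.range
      (fderiv ℝ (ι ∘ (extChartAt (𝓡 d) x₀).symm) (extChartAt (𝓡 d) x₀ q)).toLinearMap := by
  unfold tangentSubspace
  rw [differential_embedding_eq hι hq]
  exact LinearMap.range_comp_of_range_eq_top _
    (LinearMap.range_eq_top.2 (mfderiv_extChartAt_surjective hq))

theorem fderiv_embedding_injective (hι : Manifold.IsSmoothEmbedding (𝓡 d) (𝓡 D) ∞ ι)
    {x₀ : M} {y : Euc d} (hy : y ∈ (extChartAt (𝓡 d) x₀).target) :
    Function.Injective (fderiv ℝ (ι ∘ (extChartAt (𝓡 d) x₀).symm) y) := by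
  have hq := (extChartAt (𝓡 d) x₀).map_target hy
  have hinj := injective_differential hι ((extChartAt (𝓡 d) x₀).symm y)
  rw [differential_embedding_eq hι hq, (extChartAt (𝓡 d) x₀).right_inv hy] at hinj
  exact Function.Injective.of_comp_right hinj (mfderiv_extChartAt_surjective hq)

theorem contDiffOn_tangentProj (hι : Manifold.IsSmoothEmbedding (𝓡 d) (𝓡 D) ∞ ι) (x₀ : M) :
    ContDiffOn ℝ ∞ (tangentProj d ι ∘ (extChartAt (𝓡 d) x₀).symm)
      (extChartAt (𝓡 d) x₀).target := by
  have hopen := isOpen_extChartAt_target (I := 𝓡 d) x₀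
  intro y hy
  have hB : ContDiffAt ℝ ∞ (fderiv ℝ (ι ∘ (extChartAt (𝓡 d) x₀).symm)) y :=
    (contDiffAt_comp_extChartAt_symm hι.contMDiff hy).fderiv_right (by simp)
  refine ((contDiffAt_starProjection_range hB ?_).congr_of_eventuallyEq ?_).contDiffWithinAt
  · filter_upwards [hopen.mem_nhds hy] with z hz using fderiv_embedding_injective hι hz
  · filter_upwards [hopen.mem_nhds hy] with z hz
    have h := tangentSubspace_eq_range_fderiv hι ((extChartAt (𝓡 d) x₀).map_target hz)
    rw [(extChartAt (𝓡 d) x₀).right_inv hz] at h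
    simp only [Function.comp_apply, tangentProj, h]

theorem contDiffAt_tangentProj (hι : Manifold.IsSmoothEmbedding (𝓡 d) (𝓡 D) ∞ ι) {x₀ q : M}
    (hq : q ∈ (extChartAt (𝓡 d) x₀).source) :
    ContDiffAt ℝ ∞ (tangentProj d ι ∘ (extChartAt (𝓡 d) x₀).symm) (extChartAt (𝓡 d) x₀ q) :=
  (contDiffOn_tangentProj hι x₀).contDiffAt
    ((isOpen_extChartAt_target (I := 𝓡 d) x₀).mem_nhds ((extChartAt (𝓡 d) x₀).map_source hq))

theorem differential_tangentProj_eq (hι : Manifold.IsSmoothEmbedding (𝓡 d) (𝓡 D) ∞ ι)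
    {x₀ q : M} (hq : q ∈ (extChartAt (𝓡 d) x₀).source) :
    differential d (tangentProj d ι) q =
      (fderiv ℝ (tangentProj d ι ∘ (extChartAt (𝓡 d) x₀).symm) (extChartAt (𝓡 d) x₀ q)).comp
        (mfderiv (𝓡 d) (𝓡 d) (extChartAt (𝓡 d) x₀) q) :=
  differential_eq_fderiv_comp hq ((contDiffAt_tangentProj hι hq).differentiableAt (by simp))

/-- Taking adjoints is a continuous linear map that fixes every value of the projection, so by
uniqueness of the derivative it also fixes the velocities. -/
theorem adjoint_differential_tangentProj (hι : Manifold.IsSmoothEmbedding (𝓡 d) (𝓡 D) ∞ ι)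
    (p : M) (u : TangentSpace (𝓡 d) p) :
    (differential d (tangentProj d ι) p u).adjoint = differential d (tangentProj d ι) p u := by
  have hp := mem_extChartAt_source (I := 𝓡 d) p
  have hd := ((contDiffAt_tangentProj hι hp).differentiableAt (by simp)).hasFDerivAt
  rw [differential_tangentProj_eq hι hp]
  let J : (Euc D →L[ℝ] Euc D) →L[ℝ] (Euc D →L[ℝ] Euc D) :=
    (ContinuousLinearMap.adjoint (𝕜 := ℝ) (E := Euc D)
      (F := Euc D)).toLinearIsometry.toContinuousLinearMap
  have h1 := J.hasFDerivAt.comp _ hd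
  have h2 : J ∘ (tangentProj d ι ∘ (extChartAt (𝓡 d) p).symm) =
      tangentProj d ι ∘ (extChartAt (𝓡 d) p).symm := by
    funext y; exact adjoint_tangentProj _
  rw [h2] at h1
  have h3 := h1.unique hd
  exact congrArg (fun L => L (mfderiv (𝓡 d) (𝓡 d) (extChartAt (𝓡 d) p) p u)) h3

/-- This is the product rule applied to `P ∘ P = P`. -/
theorem differential_tangentProj_comp (hι : Manifold.IsSmoothEmbedding (𝓡 d) (𝓡 D) ∞ ι)
    (p : M) (u : TangentSpace (𝓡 d) p) :
    differential d (tangentProj d ι) p u ∘L tangentProj d ι p +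
      tangentProj d ι p ∘L differential d (tangentProj d ι) p u =
        differential d (tangentProj d ι) p u := by
  have hp := mem_extChartAt_source (I := 𝓡 d) p
  have hd := ((contDiffAt_tangentProj hι hp).differentiableAt (by simp)).hasFDerivAt
  rw [differential_tangentProj_eq hι hp]
  have h1 := hd.clm_comp hd
  have h2 : (fun y => (tangentProj d ι ∘ (extChartAt (𝓡 d) p).symm) y ∘L
      (tangentProj d ι ∘ (extChartAt (𝓡 d) p).symm) y) =
      tangentProj d ι ∘ (extChartAt (𝓡 d) p).symm := by
    funext y; exact tangentProj_comp_self _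
  rw [h2] at h1
  have h3 := congrArg (fun L => L (mfderiv (𝓡 d) (𝓡 d) (extChartAt (𝓡 d) p) p u)) (h1.unique hd)
  simp at h3
  rw [add_comm]
  exact h3

theorem hasFDerivAt_fderiv_embedding (hι : Manifold.IsSmoothEmbedding (𝓡 d) (𝓡 D) ∞ ι) (p : M) :
    HasFDerivAt (fderiv ℝ (ι ∘ (extChartAt (𝓡 d) p).symm))
      (fderiv ℝ (fderiv ℝ (ι ∘ (extChartAt (𝓡 d) p).symm)) (extChartAt (𝓡 d) p p))
      (extChartAt (𝓡 d) p p) := by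
  have hB : ContDiffAt ℝ ∞ (fderiv ℝ (ι ∘ (extChartAt (𝓡 d) p).symm)) (extChartAt (𝓡 d) p p) :=
    (contDiffAt_comp_extChartAt_symm hι.contMDiff (mem_extChartAt_target p)).fderiv_right (by simp)
  exact (hB.differentiableAt (by simp)).hasFDerivAt

theorem hasFDerivAt_fderiv_embedding_apply (hι : Manifold.IsSmoothEmbedding (𝓡 d) (𝓡 D) ∞ ι)
    (p : M) (w : Euc d) :
    HasFDerivAt (fun y => fderiv ℝ (ι ∘ (extChartAt (𝓡 d) p).symm) y w)
      ((fderiv ℝ (fderiv ℝ (ι ∘ (extChartAt (𝓡 d) p).symm)) (extChartAt (𝓡 d) p p)).flip w)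
      (extChartAt (𝓡 d) p p) := by
  simpa using (hasFDerivAt_fderiv_embedding hι p).clm_apply
    (hasFDerivAt_const w (extChartAt (𝓡 d) p p))

/-- The flat derivative at `p` of a vector field with constant coefficients in the chart centred
at `p` is the second derivative of the embedding in that chart. -/
theorem differential_extendTangent (hι : Manifold.IsSmoothEmbedding (𝓡 d) (𝓡 D) ∞ ι) (p : M)
    (u w : TangentSpace (𝓡 d) p) :
    differential d (fun q => differential d ι q (extendTangent p w q)) p u =
      fderiv ℝ (fderiv ℝ (ι ∘ (extChartAt (𝓡 d) p).symm)) (extChartAt (𝓡 d) p p)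
        (mfderiv (𝓡 d) (𝓡 d) (extChartAt (𝓡 d) p) p u)
        (mfderiv (𝓡 d) (𝓡 d) (extChartAt (𝓡 d) p) p w) := by
  have : IsManifold (𝓡 d) 1 M := IsManifold.of_le (n := ∞) (by simp)
  have hp := mem_extChartAt_source (I := 𝓡 d) p
  have h1 := hasFDerivAt_fderiv_embedding_apply hι p
    (mfderiv (𝓡 d) (𝓡 d) (extChartAt (𝓡 d) p) p w)
  have h2 := h1.congr_of_eventuallyEq (f₁ := (fun q => differential d ι q (extendTangent p w q)) ∘
      (extChartAt (𝓡 d) p).symm) (by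
    filter_upwards [(isOpen_extChartAt_target (I := 𝓡 d) p).mem_nhds (mem_extChartAt_target p)]
      with y hy
    have hq := (extChartAt (𝓡 d) p).map_target hy
    -- The extended field is a pullback of a constant field, so the chart differential makes it
    -- constant again and only the embedding is differentiated.
    have h : mfderiv (𝓡 d) (𝓡 d) (extChartAt (𝓡 d) p) ((extChartAt (𝓡 d) p).symm y)
        (extendTangent p w ((extChartAt (𝓡 d) p).symm y)) =
          mfderiv (𝓡 d) (𝓡 d) (extChartAt (𝓡 d) p) p w :=
      ((isInvertible_mfderiv_extChartAt hq).inverse_apply_eq.1 rfl).symm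
    simp only [Function.comp_apply]
    rw [differential_embedding_eq hι hq, (extChartAt (𝓡 d) p).right_inv hy]
    exact congrArg (fderiv ℝ (ι ∘ (extChartAt (𝓡 d) p).symm) y) h)
  rw [differential_eq_fderiv_comp hp h2.differentiableAt, h2.fderiv]
  rfl

theorem secondFundamentalForm_eq (hι : Manifold.IsSmoothEmbedding (𝓡 d) (𝓡 D) ∞ ι) (p : M)
    (x y : tangentSubspace d ι p) :
    secondFundamentalForm hι p x y = (tangentSubspace d ι p)ᗮ.starProjection
      (fderiv ℝ (fderiv ℝ (ι ∘ (extChartAt (𝓡 d) p).symm)) (extChartAt (𝓡 d) p p)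
        (mfderiv (𝓡 d) (𝓡 d) (extChartAt (𝓡 d) p) p ((tangentEquiv hι p).symm x))
        (mfderiv (𝓡 d) (𝓡 d) (extChartAt (𝓡 d) p) p ((tangentEquiv hι p).symm y))) := by
  unfold secondFundamentalForm normalDerivative
  rw [differential_extendTangent hι]

/-- Symmetry is that of the second derivative of the embedding in the chart. -/
theorem secondFundamentalForm_comm (hι : Manifold.IsSmoothEmbedding (𝓡 d) (𝓡 D) ∞ ι) (p : M)
    (x y : tangentSubspace d ι p) :
    secondFundamentalForm hι p x y = secondFundamentalForm hι p y x := by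
  rw [secondFundamentalForm_eq, secondFundamentalForm_eq]
  congr 1
  exact ((contDiffAt_comp_extChartAt_symm hι.contMDiff (mem_extChartAt_target p)).isSymmSndFDerivAt
    (by simpa using (WithTop.coe_le_coe.2 (le_top : (2 : ℕ∞) ≤ ⊤)))) _ _

/-- With `f` the embedding in the chart, differentiating `P (Df w) = Df w` along `u` gives `DP(u)
(Df w) + P (D²f(u, w)) = D²f(u, w)`. -/
theorem starProjection_orthogonal_fderiv_fderiv
    (hι : Manifold.IsSmoothEmbedding (𝓡 d) (𝓡 D) ∞ ι) (p : M) (u w : Euc d) :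
    (tangentSubspace d ι p)ᗮ.starProjection
      (fderiv ℝ (fderiv ℝ (ι ∘ (extChartAt (𝓡 d) p).symm)) (extChartAt (𝓡 d) p p) u w) =
    fderiv ℝ (tangentProj d ι ∘ (extChartAt (𝓡 d) p).symm) (extChartAt (𝓡 d) p p) u
      (fderiv ℝ (ι ∘ (extChartAt (𝓡 d) p).symm) (extChartAt (𝓡 d) p p) w) := by
  have hp := mem_extChartAt_source (I := 𝓡 d) p
  have hd := ((contDiffAt_tangentProj hι hp).differentiableAt (by simp)).hasFDerivAt
  have hf := hasFDerivAt_fderiv_embedding_apply hι p w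
  have h2 := (hd.clm_apply hf).congr_of_eventuallyEq (f₁ := fun z =>
      fderiv ℝ (ι ∘ (extChartAt (𝓡 d) p).symm) z w) (by
    filter_upwards [(isOpen_extChartAt_target (I := 𝓡 d) p).mem_nhds (mem_extChartAt_target p)]
      with z hz
    have h := tangentSubspace_eq_range_fderiv hι ((extChartAt (𝓡 d) p).map_target hz)
    rw [(extChartAt (𝓡 d) p).right_inv hz] at h
    symm
    simp only [Function.comp_apply, tangentProj]
    rw [Submodule.starProjection_eq_self_iff, h]
    exact LinearMap.mem_range_self _ _)
  have h3 := congrArg (fun L => L u) (h2.unique hf)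
  simp only [_root_.add_apply, ContinuousLinearMap.comp_apply, ContinuousLinearMap.flip_apply,
    Function.comp_apply, (extChartAt (𝓡 d) p).left_inv hp] at h3
  rw [Submodule.starProjection_orthogonal']
  change _ - tangentProj d ι p _ = _
  rw [sub_eq_iff_eq_add, add_comm]
  exact h3.symm

/-- The second fundamental form is the differential of the tangential projection. -/
theorem secondFundamentalForm_eq_differential (hι : Manifold.IsSmoothEmbedding (𝓡 d) (𝓡 D) ∞ ι)
    (p : M) (x y : tangentSubspace d ι p) :
    secondFundamentalForm hι p x y =
      differential d (tangentProj d ι) p ((tangentEquiv hι p).symm x) y := by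
  have hp := mem_extChartAt_source (I := 𝓡 d) p
  have hy : differential d ι p ((tangentEquiv hι p).symm y) = y :=
    congrArg Subtype.val ((tangentEquiv hι p).apply_symm_apply y)
  rw [secondFundamentalForm_eq, differential_tangentProj_eq hι hp, ← hy,
    differential_embedding_eq hι hp]
  exact starProjection_orthogonal_fderiv_fderiv hι p _ _

end Charts

/-! ### Gram determinants and the Grassmannian form -/

theorem posSemidef_gram_of_nonneg {V : Type*} [AddCommGroup V] [Module ℝ V]
    (B : V →ₗ[ℝ] V →ₗ[ℝ] ℝ)
    (hsymm : ∀ v w, B v w = B w v) (hnonneg : ∀ v, 0 ≤ B v v) {n : Type*} [Fintype n]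
    (v : n → V) : (Matrix.of fun i j => B (v i) (v j)).PosSemidef := by
  rw [Matrix.posSemidef_iff_dotProduct_mulVec]
  refine ⟨Matrix.IsHermitian.ext fun i j => by simp [hsymm (v j)], fun x => ?_⟩
  have h : star x ⬝ᵥ (Matrix.of fun i j => B (v i) (v j)).mulVec x =
      B (∑ i, x i • v i) (∑ j, x j • v j) := by
    simp only [dotProduct, Matrix.mulVec, map_sum, LinearMap.sum_apply, map_smul,
      LinearMap.smul_apply, Matrix.of_apply, smul_eq_mul, Finset.mul_sum, star_trivial]
    rw [Finset.sum_comm]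
    exact Finset.sum_congr rfl fun i _ => Finset.sum_congr rfl fun j _ => by ring
  rw [h]
  exact hnonneg _

/-- If `B ≤ r E` as quadratic forms then the Gram determinants satisfy
`√(det B) ≤ r ^ (d / 2) √(det E)`. -/
theorem sqrt_det_gram_le {V : Type*} [AddCommGroup V] [Module ℝ V] (B E : V →ₗ[ℝ] V →ₗ[ℝ] ℝ)
    (hBsymm : ∀ v w, B v w = B w v) (hEsymm : ∀ v w, E v w = E w v) (hB : ∀ v, 0 ≤ B v v) {r : ℝ}
    (hr : 0 ≤ r) (hBE : ∀ v, B v v ≤ r * E v v) {d : ℕ} (v : Fin d → V) :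
    √(Matrix.det (Matrix.of fun i j => B (v i) (v j))) ≤
      r ^ ((d : ℝ) / 2) * √(Matrix.det (Matrix.of fun i j => E (v i) (v j))) := by
  have h1 := posSemidef_gram_of_nonneg B hBsymm hB v
  have h2 := posSemidef_gram_of_nonneg (r • E - B) (fun v w => by simp [hBsymm v w, hEsymm v w])
    (fun v => by simpa using hBE v) v
  have h3 : (Matrix.of fun i j => (r • E - B) (v i) (v j)) =
      r • (Matrix.of fun i j => E (v i) (v j)) - Matrix.of fun i j => B (v i) (v j) := by
    ext i j; simp
  rw [h3] at h2
  have h4 := det_le_det_of_posSemidef_sub h1 h2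
  rw [Matrix.det_smul, Fintype.card_fin] at h4
  refine (Real.sqrt_le_sqrt h4).trans_eq ?_
  rw [Real.sqrt_mul (by positivity), Real.sqrt_eq_rpow (r ^ d), ← Real.rpow_natCast,
    ← Real.rpow_mul hr, mul_one_div]

/-- The metric of the Grassmannian as a bilinear form. -/
noncomputable def grassmannForm (D : ℕ) :
    (Euc D →L[ℝ] Euc D) →ₗ[ℝ] (Euc D →L[ℝ] Euc D) →ₗ[ℝ] ℝ :=
  LinearMap.mk₂ ℝ grassmannMetric
    (fun A B C => by
      simp only [grassmannMetric, map_add, ContinuousLinearMap.add_comp,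
        ContinuousLinearMap.toLinearMap_add, mul_add])
    (fun r A B => by
      simp only [grassmannMetric, map_smulₛₗ, ContinuousLinearMap.smul_comp,
        ContinuousLinearMap.toLinearMap_smul, smul_eq_mul, conj_trivial, RingHom.id_apply]
      ring)
    (fun A B C => by
      simp only [grassmannMetric, map_add, ContinuousLinearMap.comp_add,
        ContinuousLinearMap.toLinearMap_add, mul_add])
    (fun r A B => by
      simp only [grassmannMetric, ContinuousLinearMap.comp_smul,
        ContinuousLinearMap.toLinearMap_smul, map_smul, smul_eq_mul]
      ring)

theorem grassmannMetric_comm {D : ℕ} (A B : Euc D →L[ℝ] Euc D) :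
    grassmannMetric A B = grassmannMetric B A := by
  unfold grassmannMetric
  rw [LinearMap.trace_eq_sum_inner _ (EuclideanSpace.basisFun (Fin D) ℝ),
    LinearMap.trace_eq_sum_inner _ (EuclideanSpace.basisFun (Fin D) ℝ)]
  congr 1
  refine Finset.sum_congr rfl fun i _ => ?_
  simp only [ContinuousLinearMap.coe_coe, ContinuousLinearMap.comp_apply,
    ContinuousLinearMap.adjoint_inner_right]
  exact real_inner_comm _ _

/-! ### Uniform bounds on the second fundamental form -/

section Bounds

variable {d D : ℕ} {M : Type*} [TopologicalSpace M] [ChartedSpace (Euc d) M]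
variable [IsManifold (𝓡 d) ∞ M] {ι : M → Euc D}

theorem grassmannMetric_differential_self (hι : Manifold.IsSmoothEmbedding (𝓡 d) (𝓡 D) ∞ ι)
    (p : M) (u : TangentSpace (𝓡 d) p) :
    grassmannMetric (differential d (tangentProj d ι) p u) (differential d (tangentProj d ι) p u) =
      ∑ i, ‖differential d (tangentProj d ι) p u
        (stdOrthonormalBasis ℝ (tangentSubspace d ι p) i)‖ ^ 2 :=
  half_trace_eq_sum (adjoint_differential_tangentProj hι p u)
    (differential_tangentProj_comp hι p u) _

theorem hsNorm_secondFundamentalForm_sq (hι : Manifold.IsSmoothEmbedding (𝓡 d) (𝓡 D) ∞ ι)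
    (p : M) (x : tangentSubspace d ι p) :
    (hsNorm fun y => secondFundamentalForm hι p x y) ^ 2 =
      ∑ i, ‖differential d (tangentProj d ι) p ((tangentEquiv hι p).symm x)
        (stdOrthonormalBasis ℝ (tangentSubspace d ι p) i)‖ ^ 2 := by
  unfold hsNorm
  rw [Real.sq_sqrt (by positivity)]
  simp only [secondFundamentalForm_eq_differential]

theorem exists_eventually_norm_le_of_injective {V W Z : Type*} [NormedAddCommGroup V]
    [NormedSpace ℝ V] [FiniteDimensional ℝ V] [NormedAddCommGroup W] [NormedSpace ℝ W]
    [TopologicalSpace Z] {B : Z → V →L[ℝ] W} {z₀ : Z} (hB : ContinuousAt B z₀)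
    (hinj : Function.Injective (B z₀)) :
    ∃ K : ℝ, 0 ≤ K ∧ ∀ᶠ z in nhds z₀, ∀ v, ‖v‖ ≤ K * ‖B z v‖ := by
  obtain ⟨K, hK, hanti⟩ := LinearMap.exists_antilipschitzWith (B z₀).toLinearMap
    (LinearMap.ker_eq_bot.2 hinj)
  have hK' : (0 : ℝ) < K := hK
  -- A perturbation of norm below `1 / (2K)` costs at most `‖v‖ / 2` in `‖v‖ ≤ K ‖B z₀ v‖`;
  -- absorbing it doubles the constant.
  refine ⟨2 * K, by positivity, ?_⟩
  have hε : (0 : ℝ) < 1 / (2 * K) := by positivity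
  filter_upwards [Metric.continuousAt_iff'.1 hB _ hε] with z hz v
  rw [dist_eq_norm] at hz
  have h1 : ‖v‖ ≤ K * ‖B z₀ v‖ := by
    have := hanti.le_mul_dist v 0
    simpa using this
  have h2 : ‖B z₀ v‖ ≤ ‖B z v‖ + 1 / (2 * K) * ‖v‖ := by
    calc ‖B z₀ v‖ = ‖B z v - (B z - B z₀) v‖ := by simp
      _ ≤ ‖B z v‖ + ‖(B z - B z₀) v‖ := norm_sub_le _ _
      _ ≤ _ := by
        gcongr
        exact ((B z - B z₀).le_opNorm v).trans (by gcongr)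
  have h3 : ‖v‖ ≤ K * ‖B z v‖ + ‖v‖ / 2 := by
    calc ‖v‖ ≤ K * (‖B z v‖ + 1 / (2 * K) * ‖v‖) := h1.trans (by gcongr)
      _ = _ := by field_simp
  linarith

theorem exists_eventually_opNorm_le {V W Z : Type*} [NormedAddCommGroup V] [NormedSpace ℝ V]
    [NormedAddCommGroup W] [NormedSpace ℝ W] [TopologicalSpace Z] {B : Z → V →L[ℝ] W} {z₀ : Z}
    (hB : ContinuousAt B z₀) : ∃ C : ℝ, 0 ≤ C ∧ ∀ᶠ z in nhds z₀, ‖B z‖ ≤ C :=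
  ⟨‖B z₀‖ + 1, by positivity,
    (hB.norm.eventually (gt_mem_nhds (lt_add_one _))).mono fun _ h => le_of_lt h⟩

/-- Both differentials factor through the same chart differential, so it suffices to bound the
derivative of `P` in the chart above and that of the embedding below, near one point. -/
theorem eventually_norm_differential_tangentProj_le
    (hι : Manifold.IsSmoothEmbedding (𝓡 d) (𝓡 D) ∞ ι) (x₀ : M) :
    ∃ C : ℝ, ∀ᶠ q in nhds x₀, ∀ u : TangentSpace (𝓡 d) q,
      ‖differential d (tangentProj d ι) q u‖ ≤ C * ‖differential d ι q u‖ := by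
  have h0 := mem_extChartAt_source (I := 𝓡 d) x₀
  have hB : ContDiffAt ℝ ∞ (fderiv ℝ (ι ∘ (extChartAt (𝓡 d) x₀).symm)) (extChartAt (𝓡 d) x₀ x₀) :=
    (contDiffAt_comp_extChartAt_symm hι.contMDiff (mem_extChartAt_target x₀)).fderiv_right (by simp)
  have hQ : ContDiffAt ℝ ∞ (fderiv ℝ (tangentProj d ι ∘ (extChartAt (𝓡 d) x₀).symm))
      (extChartAt (𝓡 d) x₀ x₀) := (contDiffAt_tangentProj hι h0).fderiv_right (by simp)
  have hφ : Filter.Tendsto (extChartAt (𝓡 d) x₀) (nhds x₀) (nhds (extChartAt (𝓡 d) x₀ x₀)) :=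
    continuousAt_extChartAt x₀
  obtain ⟨K, hK0, hK⟩ := exists_eventually_norm_le_of_injective hB.continuousAt
    (fderiv_embedding_injective hι (mem_extChartAt_target x₀))
  obtain ⟨C, hC0, hC⟩ := exists_eventually_opNorm_le hQ.continuousAt
  refine ⟨C * K, ?_⟩
  filter_upwards [hφ.eventually hK, hφ.eventually hC, extChartAt_source_mem_nhds (I := 𝓡 d) x₀]
    with q hq1 hq2 hq u
  rw [differential_tangentProj_eq hι hq, differential_embedding_eq hι hq]
  refine (ContinuousLinearMap.le_opNorm _ _).trans ?_
  rw [mul_assoc]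
  exact mul_le_mul hq2 (hq1 _) (norm_nonneg _) hC0

theorem exists_norm_differential_tangentProj_le [CompactSpace M]
    (hι : Manifold.IsSmoothEmbedding (𝓡 d) (𝓡 D) ∞ ι) :
    ∃ C : ℝ, ∀ q, ∀ u : TangentSpace (𝓡 d) q,
      ‖differential d (tangentProj d ι) q u‖ ≤ C * ‖differential d ι q u‖ := by
  have h := isCompact_univ.induction_on (X := M) (p := fun s => ∃ C : ℝ, ∀ q ∈ s,
    ∀ u : TangentSpace (𝓡 d) q,
      ‖differential d (tangentProj d ι) q u‖ ≤ C * ‖differential d ι q u‖)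
    ⟨0, by simp⟩ (fun s t hst ⟨C, hC⟩ => ⟨C, fun q hq => hC q (hst hq)⟩)
    (fun s t ⟨C, hC⟩ ⟨C', hC'⟩ => ⟨max C C', fun q hq u => by
      rcases hq with hq | hq
      · exact (hC q hq u).trans (by gcongr; exact le_max_left _ _)
      · exact (hC' q hq u).trans (by gcongr; exact le_max_right _ _)⟩)
    (fun x _ => by
      obtain ⟨C, hC⟩ := eventually_norm_differential_tangentProj_le hι x
      exact ⟨_, mem_nhdsWithin_of_mem_nhds hC, C, fun q hq => hq⟩)
  obtain ⟨C, hC⟩ := h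
  exact ⟨C, fun q => hC q (Set.mem_univ q)⟩

theorem differential_tangentEquiv_symm (hι : Manifold.IsSmoothEmbedding (𝓡 d) (𝓡 D) ∞ ι) (p : M)
    (x : tangentSubspace d ι p) : differential d ι p ((tangentEquiv hι p).symm x) = x :=
  congrArg Subtype.val ((tangentEquiv hι p).apply_symm_apply x)

/-- A real supremum of an unbounded family is `0` by convention, so `hsSup` and `curvatureNorm`
dominate their terms only once this uniform bound is available. -/
theorem exists_norm_secondFundamentalForm_le [CompactSpace M]
    (hι : Manifold.IsSmoothEmbedding (𝓡 d) (𝓡 D) ∞ ι) :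
    ∃ C : ℝ, 0 ≤ C ∧ ∀ p (x y : tangentSubspace d ι p),
      ‖secondFundamentalForm hι p x y‖ ≤ C * ‖x‖ * ‖y‖ := by
  obtain ⟨C, hC⟩ := exists_norm_differential_tangentProj_le hι
  refine ⟨max C 0, le_max_right _ _, fun p x y => ?_⟩
  rw [secondFundamentalForm_eq_differential]
  refine (ContinuousLinearMap.le_opNorm _ _).trans ?_
  have h := hC p ((tangentEquiv hι p).symm x)
  rw [differential_tangentEquiv_symm] at h
  have h' : C * ‖(x : Euc D)‖ ≤ max C 0 * ‖x‖ := by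
    rw [Submodule.coe_norm]; gcongr; exact le_max_left _ _
  exact mul_le_mul (h.trans h') le_rfl (norm_nonneg _) (by positivity)

theorem le_hsSup [CompactSpace M] (hι : Manifold.IsSmoothEmbedding (𝓡 d) (𝓡 D) ∞ ι) (p : M)
    {x : tangentSubspace d ι p} (hx : ‖x‖ = 1) :
    (hsNorm fun y => secondFundamentalForm hι p x y) ≤ hsSup hι := by
  obtain ⟨C, hC0, hC⟩ := exists_norm_secondFundamentalForm_le hι
  have hb : ∀ (p : M) (v : Metric.sphere (0 : tangentSubspace d ι p) 1),
      (hsNorm fun y => secondFundamentalForm hι p v y) ≤ √(d * C ^ 2) := by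
    intro p v
    refine Real.sqrt_le_sqrt ?_
    calc _ ≤ ∑ _i : Fin (Module.finrank ℝ (tangentSubspace d ι p)), C ^ 2 := by
          refine Finset.sum_le_sum fun i _ => ?_
          have h := hC p v (stdOrthonormalBasis ℝ (tangentSubspace d ι p) i)
          rw [(stdOrthonormalBasis ℝ (tangentSubspace d ι p)).orthonormal.1 i,
            mem_sphere_zero_iff_norm.1 v.2, mul_one, mul_one] at h
          gcongr
      _ = _ := by simp [finrank_tangentSubspace hι p]
  refine le_ciSup_of_le ⟨√(d * C ^ 2), ?_⟩ p (le_ciSup_of_le ⟨√(d * C ^ 2), ?_⟩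
    (⟨x, mem_sphere_zero_iff_norm.2 hx⟩ : Metric.sphere (0 : tangentSubspace d ι p) 1) le_rfl)
  · rintro _ ⟨p, rfl⟩
    -- The unit sphere is empty when `d = 0`; the inner supremum is then `0`, hence the need for a
    -- nonnegative bound.
    exact Real.iSup_le (hb p) (Real.sqrt_nonneg _)
  · rintro _ ⟨v, rfl⟩
    exact hb p v

theorem le_curvatureNorm [CompactSpace M] (hι : Manifold.IsSmoothEmbedding (𝓡 d) (𝓡 D) ∞ ι)
    (p : M) {x : tangentSubspace d ι p} (hx : ‖x‖ = 1) :
    ‖secondFundamentalForm hι p x x‖ ≤ curvatureNorm hι := by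
  obtain ⟨C, hC0, hC⟩ := exists_norm_secondFundamentalForm_le hι
  have hb : ∀ (p : M) (v : Metric.sphere (0 : tangentSubspace d ι p) 1),
      ‖secondFundamentalForm hι p v v‖ ≤ C := by
    intro p v
    have h := hC p v v
    rwa [mem_sphere_zero_iff_norm.1 v.2, mul_one, mul_one] at h
  refine le_ciSup_of_le ⟨C, ?_⟩ p (le_ciSup_of_le ⟨C, ?_⟩
    (⟨x, mem_sphere_zero_iff_norm.2 hx⟩ : Metric.sphere (0 : tangentSubspace d ι p) 1) le_rfl)
  · rintro _ ⟨p, rfl⟩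
    exact Real.iSup_le (hb p) hC0
  · rintro _ ⟨v, rfl⟩
    exact hb p v

theorem hsSup_nonneg (hι : Manifold.IsSmoothEmbedding (𝓡 d) (𝓡 D) ∞ ι) : 0 ≤ hsSup hι :=
  Real.iSup_nonneg fun _ => Real.iSup_nonneg fun _ => Real.sqrt_nonneg _

theorem curvatureNorm_nonneg (hι : Manifold.IsSmoothEmbedding (𝓡 d) (𝓡 D) ∞ ι) :
    0 ≤ curvatureNorm hι :=
  Real.iSup_nonneg fun _ => Real.iSup_nonneg fun _ => norm_nonneg _

theorem norm_secondFundamentalForm_self_le [CompactSpace M]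
    (hι : Manifold.IsSmoothEmbedding (𝓡 d) (𝓡 D) ∞ ι) (p : M) (x : tangentSubspace d ι p) :
    ‖secondFundamentalForm hι p x x‖ ≤ curvatureNorm hι * ‖x‖ ^ 2 := by
  rcases eq_or_ne x 0 with rfl | hx
  · simp [secondFundamentalForm_eq_differential]
  have hx' : ‖x‖ ≠ 0 := norm_ne_zero_iff.2 hx
  have h := le_curvatureNorm hι p (x := ‖x‖⁻¹ • x) (by
    rw [norm_smul, norm_inv, norm_norm, inv_mul_cancel₀ (norm_ne_zero_iff.2 hx)])
  simp only [secondFundamentalForm_eq_differential, map_smul, Submodule.coe_smul,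
    _root_.smul_apply, norm_smul, norm_inv, norm_norm] at h ⊢
  rwa [← mul_assoc, ← sq, inv_pow, inv_mul_le_iff₀ (by positivity), mul_comm] at h

/-- Polarization: `4 II(x, y) = II(x + y, x + y) - II(x - y, x - y)`, and for unit vectors `‖x + y‖²
+ ‖x - y‖² = 4`, so no constant is lost. -/
theorem norm_secondFundamentalForm_le [CompactSpace M]
    (hι : Manifold.IsSmoothEmbedding (𝓡 d) (𝓡 D) ∞ ι) (p : M) {x : tangentSubspace d ι p}
    (hx : ‖x‖ = 1) (y : tangentSubspace d ι p) :
    ‖secondFundamentalForm hι p x y‖ ≤ curvatureNorm hι * ‖y‖ := by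
  have key : ∀ y : tangentSubspace d ι p, ‖y‖ = 1 →
      ‖secondFundamentalForm hι p x y‖ ≤ curvatureNorm hι := by
    intro y hy
    have h1 := norm_secondFundamentalForm_self_le hι p (x + y)
    have h2 := norm_secondFundamentalForm_self_le hι p (x - y)
    have h3 : (4 : ℝ) • secondFundamentalForm hι p x y =
        secondFundamentalForm hι p (x + y) (x + y) - secondFundamentalForm hι p (x - y) (x - y) := by
      have hc := secondFundamentalForm_comm hι p x y
      simp only [secondFundamentalForm_eq_differential, map_add, map_sub, Submodule.coe_add,
        Submodule.coe_sub, _root_.add_apply, _root_.sub_apply] at hc ⊢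
      rw [← hc]
      module
    have h4 := parallelogram_law_with_norm ℝ x y
    rw [hx, hy] at h4
    have h5 : 4 * ‖secondFundamentalForm hι p x y‖ ≤
        ‖secondFundamentalForm hι p (x + y) (x + y)‖ +
          ‖secondFundamentalForm hι p (x - y) (x - y)‖ := by
      calc 4 * ‖secondFundamentalForm hι p x y‖
          = ‖(4 : ℝ) • secondFundamentalForm hι p x y‖ := by rw [norm_smul]; norm_num
        _ ≤ _ := by rw [h3]; exact norm_sub_le _ _
    have h6 : curvatureNorm hι * ‖x + y‖ ^ 2 + curvatureNorm hι * ‖x - y‖ ^ 2 =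
        4 * curvatureNorm hι := by
      linear_combination curvatureNorm hι * h4
    linarith
  rcases eq_or_ne y 0 with rfl | hy
  · simp [secondFundamentalForm_eq_differential]
  have hy' : 0 < ‖y‖ := norm_pos_iff.2 hy
  have h := key (‖y‖⁻¹ • y) (by
    rw [norm_smul, norm_inv, norm_norm, inv_mul_cancel₀ hy'.ne'])
  simp only [secondFundamentalForm_eq_differential, map_smul, Submodule.coe_smul, norm_smul,
    norm_inv, norm_norm] at h ⊢
  rwa [inv_mul_le_iff₀ hy', mul_comm] at h

theorem hsSup_sq_le [CompactSpace M] (hι : Manifold.IsSmoothEmbedding (𝓡 d) (𝓡 D) ∞ ι) :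
    hsSup hι ^ 2 ≤ curvatureNorm hι ^ 2 * (min d (D - d) : ℕ) := by
  have h : hsSup hι ≤ √(curvatureNorm hι ^ 2 * (min d (D - d) : ℕ)) := by
    refine Real.iSup_le (fun p => Real.iSup_le (fun v => ?_) (Real.sqrt_nonneg _))
      (Real.sqrt_nonneg _)
    refine Real.le_sqrt_of_sq_le ?_
    rw [hsNorm_secondFundamentalForm_sq]
    have h := sum_norm_sq_le_mul_min
      (adjoint_differential_tangentProj hι p ((tangentEquiv hι p).symm v))
      (differential_tangentProj_comp hι p ((tangentEquiv hι p).symm v)) (curvatureNorm_nonneg hι)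
      (fun y hy => by
        have := norm_secondFundamentalForm_le hι p (mem_sphere_zero_iff_norm.1 v.2) ⟨y, hy⟩
        rwa [secondFundamentalForm_eq_differential] at this)
      (stdOrthonormalBasis ℝ (tangentSubspace d ι p))
    refine h.trans_eq ?_
    rw [finrank_tangentSubspace hι p, finrank_euclideanSpace_fin]
  calc hsSup hι ^ 2 ≤ √(curvatureNorm hι ^ 2 * (min d (D - d) : ℕ)) ^ 2 :=
        pow_le_pow_left₀ (hsSup_nonneg hι) h 2
    _ = _ := Real.sq_sqrt (by positivity)

theorem grassmannMetric_differential_le [CompactSpace M]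
    (hι : Manifold.IsSmoothEmbedding (𝓡 d) (𝓡 D) ∞ ι) (p : M) (u : TangentSpace (𝓡 d) p) :
    grassmannMetric (differential d (tangentProj d ι) p u) (differential d (tangentProj d ι) p u) ≤
      hsSup hι ^ 2 * ‖differential d ι p u‖ ^ 2 := by
  obtain ⟨x, rfl⟩ := (tangentEquiv hι p).symm.surjective u
  rw [grassmannMetric_differential_self hι, differential_tangentEquiv_symm,
    ← hsNorm_secondFundamentalForm_sq]
  rcases eq_or_ne x 0 with rfl | hx
  · rw [hsNorm_secondFundamentalForm_sq]; simp
  have hx' : 0 < ‖x‖ := norm_pos_iff.2 hx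
  have h := le_hsSup hι p (x := ‖x‖⁻¹ • x) (by
    rw [norm_smul, norm_inv, norm_norm, inv_mul_cancel₀ (norm_ne_zero_iff.2 hx)])
  have h' := pow_le_pow_left₀ (show 0 ≤ hsNorm _ from Real.sqrt_nonneg _) h 2
  rw [hsNorm_secondFundamentalForm_sq] at h' ⊢
  simp only [map_smul, _root_.smul_apply, norm_smul, norm_inv, norm_norm, mul_pow,
    ← Finset.mul_sum] at h'
  rw [inv_pow, inv_mul_le_iff₀ (by positivity), mul_comm] at h'
  exact h'

end Bounds

/-! ### Comparison and finiteness of volumes -/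

section Volume

variable {d D : ℕ} {M : Type*} [TopologicalSpace M] [ChartedSpace (Euc d) M]
variable [IsManifold (𝓡 d) ∞ M] {ι : M → Euc D}

theorem volumeDensity_gaussMetric_le [CompactSpace M]
    (hι : Manifold.IsSmoothEmbedding (𝓡 d) (𝓡 D) ∞ ι)
    (o : ∀ p : M, Orientation ℝ (TangentSpace (𝓡 d) p) (Fin d)) {c : ℝ} (hc : 0 ≤ c) (x₀ : M)
    (y : Euc d) :
    volumeDensity (gaussMetric hι o c) x₀ y ≤
      (1 + c * hsSup hι ^ 2) ^ ((d : ℝ) / 2) * volumeDensity (euclideanMetric ι) x₀ y := by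
  set p := (extChartAt (𝓡 d) x₀).symm y
  let E : TangentSpace (𝓡 d) p →ₗ[ℝ] TangentSpace (𝓡 d) p →ₗ[ℝ] ℝ :=
    (innerₗ (Euc D)).compl₁₂ (differential d ι p).toLinearMap (differential d ι p).toLinearMap
  let B : TangentSpace (𝓡 d) p →ₗ[ℝ] TangentSpace (𝓡 d) p →ₗ[ℝ] ℝ :=
    E + c • (grassmannForm D).compl₁₂ (differential d (tangentProj d ι) p).toLinearMap
      (differential d (tangentProj d ι) p).toLinearMap
  have hE : ∀ v w, E v w = euclideanMetric ι p v w := fun _ _ => rfl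
  -- Forgetting the orientation turns the Gauss map into `tangentProj` definitionally.
  have hB : ∀ v w, B v w = euclideanMetric ι p v w + c * grassmannMetric
    (differential d (tangentProj d ι) p v) (differential d (tangentProj d ι) p w) := fun _ _ => rfl
  have hEE : ∀ v, E v v = ‖differential d ι p v‖ ^ 2 := fun v =>
    real_inner_self_eq_norm_sq (differential d ι p v)
  have hEsymm : ∀ v w, E v w = E w v := fun v w =>
    real_inner_comm (differential d ι p w) (differential d ι p v)
  refine sqrt_det_gram_le B E (fun v w => ?_) hEsymm (fun v => ?_) (by positivity) (fun v => ?_)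
    (coordVector x₀ y)
  · rw [hB, hB, ← hE, ← hE, hEsymm v w, grassmannMetric_comm]
  · rw [hB, ← hE, hEE, grassmannMetric_differential_self hι]
    positivity
  · rw [hB, ← hE, hEE]
    have := mul_le_mul_of_nonneg_left (grassmannMetric_differential_le hι p v) hc
    linarith

theorem riemannianVolume_le_of_volumeDensity_le [T2Space M] [CompactSpace M]
    {g g' : ∀ p : M, TangentSpace (𝓡 d) p → TangentSpace (𝓡 d) p → ℝ} {r : ℝ} (hr : 0 ≤ r)
    (h : ∀ x₀ y, volumeDensity g' x₀ y ≤ r * volumeDensity g x₀ y) :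
    riemannianVolume g' ≤ ENNReal.ofReal r * riemannianVolume g := by
  unfold riemannianVolume
  rw [← ENNReal.tsum_mul_left]
  refine ENNReal.tsum_le_tsum fun x₀ => ?_
  -- This form asks for a finite constant instead of a measurable integrand.
  rw [← MeasureTheory.lintegral_const_mul' _ _ ENNReal.ofReal_ne_top]
  refine MeasureTheory.lintegral_mono fun y => ?_
  rw [← ENNReal.ofReal_mul hr]
  refine ENNReal.ofReal_le_ofReal ?_
  calc _ ≤ chartPartition d M x₀ ((extChartAt (𝓡 d) x₀).symm y) *
          (r * volumeDensity g x₀ y) :=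
        mul_le_mul_of_nonneg_left (h x₀ y) ((chartPartition d M).nonneg _ _)
    _ = _ := by ring

theorem differential_coordVector (hι : Manifold.IsSmoothEmbedding (𝓡 d) (𝓡 D) ∞ ι) (x₀ : M)
    {y : Euc d} (hy : y ∈ (extChartAt (𝓡 d) x₀).target) (k : Fin d) :
    differential d ι ((extChartAt (𝓡 d) x₀).symm y) (coordVector x₀ y k) =
      fderiv ℝ (ι ∘ (extChartAt (𝓡 d) x₀).symm) y (EuclideanSpace.single k (1 : ℝ)) := by
  have h1 : MDifferentiableAt (𝓡 d) (𝓡 D) ι ((extChartAt (𝓡 d) x₀).symm y) :=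
    hι.contMDiff.contMDiffAt.mdifferentiableAt (by simp)
  have h2 : MDifferentiableAt (𝓡 d) (𝓡 d) (extChartAt (𝓡 d) x₀).symm y :=
    ((contMDiffOn_extChartAt_symm (n := ∞) x₀).contMDiffAt
      ((isOpen_extChartAt_target (I := 𝓡 d) x₀).mem_nhds hy)).mdifferentiableAt (by simp)
  have h3 := mfderiv_comp y h1 h2
  rw [mfderiv_eq_fderiv] at h3
  rw [h3]
  rfl

theorem continuousOn_volumeDensity_euclideanMetric
    (hι : Manifold.IsSmoothEmbedding (𝓡 d) (𝓡 D) ∞ ι) (x₀ : M) :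
    ContinuousOn (volumeDensity (euclideanMetric ι) x₀) (extChartAt (𝓡 d) x₀).target := by
  have hf : ContinuousOn (fderiv ℝ (ι ∘ (extChartAt (𝓡 d) x₀).symm))
      (extChartAt (𝓡 d) x₀).target :=
    (contDiffOn_comp_extChartAt_symm hι.contMDiff x₀).continuousOn_fderiv_of_isOpen
      (isOpen_extChartAt_target (I := 𝓡 d) x₀) (by simp)
  have h : ContinuousOn (fun y => √(Matrix.det (Matrix.of fun i j : Fin d => (inner ℝ
      (fderiv ℝ (ι ∘ (extChartAt (𝓡 d) x₀).symm) y (EuclideanSpace.single i (1 : ℝ)))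
      (fderiv ℝ (ι ∘ (extChartAt (𝓡 d) x₀).symm) y (EuclideanSpace.single j (1 : ℝ))) : ℝ))))
      (extChartAt (𝓡 d) x₀).target := by
    refine Real.continuous_sqrt.comp_continuousOn ?_
    refine (Continuous.matrix_det continuous_id).comp_continuousOn ?_
    refine continuousOn_pi.2 fun i => continuousOn_pi.2 fun j => ?_
    exact (hf.clm_apply continuousOn_const).inner (hf.clm_apply continuousOn_const)
  refine h.congr fun y hy => ?_
  unfold volumeDensity euclideanMetric
  simp only [differential_coordVector hι x₀ hy]

theorem riemannianVolume_lt_top [T2Space M] [CompactSpace M]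
    {g : ∀ p : M, TangentSpace (𝓡 d) p → TangentSpace (𝓡 d) p → ℝ}
    (hg : ∀ x₀ : M, ContinuousOn (volumeDensity g x₀) (extChartAt (𝓡 d) x₀).target) :
    riemannianVolume g < ⊤ := by
  unfold riemannianVolume
  have hfin := (chartPartition d M).locallyFinite.finite_nonempty_of_compact
  rw [tsum_eq_sum (s := hfin.toFinset)]
  · refine ENNReal.sum_lt_top.2 fun x₀ _ => ?_
    set K := extChartAt (𝓡 d) x₀ '' tsupport (chartPartition d M x₀)
    have hsub : tsupport (chartPartition d M x₀) ⊆ (extChartAt (𝓡 d) x₀).source := by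
      rw [extChartAt_source]; exact chartPartition_isSubordinate d M x₀
    have hKc : IsCompact K :=
      (isClosed_tsupport _).isCompact.image_of_continuousOn ((continuousOn_extChartAt x₀).mono hsub)
    have hKt : K ⊆ (extChartAt (𝓡 d) x₀).target := by
      rintro _ ⟨q, hq, rfl⟩
      exact (extChartAt (𝓡 d) x₀).map_source (hsub hq)
    obtain ⟨C, hC⟩ := hKc.exists_bound_of_continuousOn ((hg x₀).mono hKt)
    -- The partition function is at most `1` and vanishes off `K`, while `C` bounds the density on
    -- `K`.
    calc _ ≤ ∫⁻ y in (extChartAt (𝓡 d) x₀).target, K.indicator (fun _ => ENNReal.ofReal C) y := by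
          refine MeasureTheory.setLIntegral_mono' (isOpen_extChartAt_target x₀).measurableSet
            fun y hy => ?_
          by_cases hyK : y ∈ K
          · rw [Set.indicator_of_mem hyK]
            refine ENNReal.ofReal_le_ofReal ?_
            have h1 := (Real.le_norm_self _).trans (hC y hyK)
            have h2 : 0 ≤ volumeDensity g x₀ y := Real.sqrt_nonneg _
            exact (mul_le_of_le_one_left h2 ((chartPartition d M).le_one _ _)).trans h1
          · have : chartPartition d M x₀ ((extChartAt (𝓡 d) x₀).symm y) = 0 := by
              by_contra hne
              exact hyK ⟨_, subset_tsupport _ hne, (extChartAt (𝓡 d) x₀).right_inv hy⟩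
            rw [this, zero_mul, ENNReal.ofReal_zero]
            exact zero_le
      _ ≤ ∫⁻ y, K.indicator (fun _ => ENNReal.ofReal C) y :=
          MeasureTheory.setLIntegral_le_lintegral _ _
      _ = ENNReal.ofReal C * MeasureTheory.volume K :=
          MeasureTheory.lintegral_indicator_const hKc.measurableSet _
      _ < ⊤ := ENNReal.mul_lt_top ENNReal.ofReal_lt_top hKc.measure_lt_top
  · intro x₀ hx₀
    have h0 : ∀ q, chartPartition d M x₀ q = 0 := by
      intro q
      by_contra hne
      exact hx₀ (hfin.mem_toFinset.2 ⟨q, hne⟩)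
    simp [h0]

end Volume

end GaussVolume

theorem mainTheorem6 {d D : ℕ} {M : Type*} [TopologicalSpace M] [ChartedSpace (Euc d) M]
    [IsManifold (𝓡 d) ∞ M] [T2Space M] [CompactSpace M] (ι : M → Euc D)
    (hι : Manifold.IsSmoothEmbedding (𝓡 d) (𝓡 D) ∞ ι)
    (o : ∀ p : M, Orientation ℝ (TangentSpace (𝓡 d) p) (Fin d)) (ho : IsManifoldOrientation o)
    (c : ℝ) (hc : 0 < c) :
    riemannianVolume (d := d) (euclideanMetric ι) < ⊤ ∧
    riemannianVolume (gaussMetric hι o c) ≤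
      ENNReal.ofReal ((1 + c * hsSup hι ^ 2) ^ ((d : ℝ) / 2)) *
        riemannianVolume (d := d) (euclideanMetric ι) ∧
    riemannianVolume (gaussMetric hι o c) ≤
      ENNReal.ofReal
          ((1 + c * curvatureNorm hι ^ 2 * (min d (D - d) : ℕ)) ^ ((d : ℝ) / 2)) *
        riemannianVolume (d := d) (euclideanMetric ι) := by
  have hle : riemannianVolume (gaussMetric hι o c) ≤
      ENNReal.ofReal ((1 + c * hsSup hι ^ 2) ^ ((d : ℝ) / 2)) *
        riemannianVolume (d := d) (euclideanMetric ι) :=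
    riemannianVolume_le_of_volumeDensity_le (by positivity)
      (volumeDensity_gaussMetric_le hι o hc.le)
  refine ⟨riemannianVolume_lt_top (continuousOn_volumeDensity_euclideanMetric hι), hle,
    hle.trans ?_⟩
  gcongr ENNReal.ofReal (?_ ^ _) * _
  rw [mul_assoc]
  gcongr
  exact hsSup_sq_le hι
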